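/- Let $n\ge 2$, $0<s<1$ and $1<p,q<\infty$ with $0<\frac1p-\frac1q<\frac sn$. A set $A\subset\mathbb R^n$ is called $\eta$-plump ($\eta\ge 1$) if for every $x\in\overline A$ and every $r\in(0,\operatorname{diam}(A))$ there is a point $z$ with $|z-x|\le r$ such that the open ball $B^n(z,r/\eta)$ is contained in $A$ (here $\operatorname{diam}(A)=\infty$ if $A$ is unbounded). Let $W^{s,p}(\mathbb R^n)$ be the set of all $u\in L^p(\mathbb R^n)$ (complex-valued) with $$|u|_{W^{s,p}(\mathbb R^n)}:=\left(\int_{\mathbb R^n}\int_{\mathbb R^n}\frac{|u(x)-u(y)|^p}{|x-y|^{sp+n}}\,dy\,dx\right)^{1/p}<\infty .$$ Then there is a constant $c_{s,n,p,q}>0$, depending only on $s,n,p,q$, such that for every $\eta\ge1$, every bounded domain (non-empty, open, connected set) $\Omega\subset\mathbb R^n$ whose complement $\mathbb R^n\setminus\Omega$ is $\eta$-plump, and every $u\in W^{s,p}(\mathbb R^n)$ with $\operatorname{spt}u=\overline{\{x:u(x)\neq0\}}\subset\overline\Omega$, $$\left(\int_\Omega\frac{|u(x)|^q}{\operatorname{dist}(x,\partial\Omega)^{q(s+n(1/q-1/p))}}\,dx\right)^{1/q}\le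 c_{s,n,p,q}\,\eta^{\,2n/q+s-n/p}\left(\int_{\mathbb R^n}\int_{\mathbb R^n}\frac{|u(x)-u(y)|^p}{|x-y|^{sp+n}}\,dy\,dx\right)^{1/p}.$$ -/

import Mathlib

open MeasureTheory
open scoped ENNReal

/-- A set `A` in `ℝⁿ` is `η`-plump if for all `x` in the closure of `A` and all
`r ∈ (0, diam A)` there is a point `z` of the closed ball of radius `r` about `x` such that
the open ball of radius `r / η` about `z` lies in `A`. The diameter is taken in `[0, ∞]`, so that
every `r > 0` is admitted when `A` is unbounded. -/
def IsPlump {n : ℕ} (η : ℝ) (A : Set (EuclideanSpace ℝ (Fin n))) : Prop :=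
  ∀ x ∈ closure A, ∀ r : ℝ, 0 < r → ENNReal.ofReal r < Metric.ediam A →
    ∃ z ∈ Metric.closedBall x r, Metric.ball z (r / η) ⊆ A

/-- The Gagliardo seminorm
`(∫_{ℝⁿ} ∫_{ℝⁿ} |u(x) - u(y)|^p / |x - y|^(s p + n) dy dx)^(1/p)`, with values in `[0, ∞]`. -/
noncomputable def gagliardoSeminorm {n : ℕ} (s p : ℝ) (u : EuclideanSpace ℝ (Fin n) → ℂ) : ℝ≥0∞ :=
  (∫⁻ x, ∫⁻ y, ‖u x - u y‖ₑ ^ p / ‖x - y‖ₑ ^ (s * p + n)) ^ (1 / p)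

/-- Membership in the fractional Sobolev space `W^{s,p}(ℝⁿ)`: `u` lies in `L^p(ℝⁿ)` and its
Gagliardo seminorm is finite. -/
def MemFracSobolev {n : ℕ} (s p : ℝ) (u : EuclideanSpace ℝ (Fin n) → ℂ) : Prop :=
  MemLp u (ENNReal.ofReal p) volume ∧ gagliardoSeminorm s p u < ∞

/-! Let `g` be the fractional gradient of `u`, so that `‖g‖_p` is the seminorm, and put `α = s - n
(1/p - 1/q) > 0`. The core is a pointwise bound: for a.e. `x ∈ Ω`, with `d = dist(x, ∂Ω)`, `|u(x)| ≤
C η^(α + n/q) d^α Ψ(x)`, where `Ψ = M(g^t)^(p/(tq)) ‖g‖_p^(1 - p/q)` for a suitable `t ∈ [1, p)`.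
Dividing by `d^α` and taking `L^q` norms finishes the proof: as `p/t > 1`, the maximal theorem gives
`‖Ψ‖_q ≤ C ‖g‖_p` (`exists_lintegral_hedbergMajorant_le`), and `α + n/q` is the exponent claimed for
`η`.

For the pointwise bound (`exists_ae_enorm_le_of_ae_eq_zero_on_ball`), plumpness supplies `z` with
`|x - z| ≤ 2d` such that `u` vanishes on `B(z, d/η)`. A chain of balls runs from `x` up to `B(x,
2d)`, across to `B(z, 2d)` and down into `B(z, d/η)`. Consecutive averages differ by at most `C ρ^s`
times a mean of `g`, and Hedberg's interpolation bounds that mean by `Ψ(x)`. Only the descent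
towards `z` costs a power of `η`. -/

/-! ### The Hardy–Littlewood maximal theorem. -/

section MaximalFunction

open Metric Set Module

variable {E : Type*} [NormedAddCommGroup E] [MeasurableSpace E] (μ : Measure E)

/-- The uncentred Hardy–Littlewood maximal function with respect to open balls. -/
noncomputable def maximalFunction (h : E → ℝ≥0∞) (x : E) : ℝ≥0∞ :=
  ⨆ (z : E) (r : ℝ) (_ : x ∈ ball z r), ⨍⁻ y in ball z r, h y ∂μ

lemma laverage_le_maximalFunction (h : E → ℝ≥0∞) {x z : E} {r : ℝ} (hx : x ∈ ball z r) :
    ⨍⁻ y in ball z r, h y ∂μ ≤ maximalFunction μ h x :=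
  le_iSup_of_le z <| le_iSup_of_le r <| le_iSup_of_le hx le_rfl

lemma lt_maximalFunction_iff {h : E → ℝ≥0∞} {a : ℝ≥0∞} {x : E} :
    a < maximalFunction μ h x ↔
      ∃ z r, x ∈ ball z r ∧ a < ⨍⁻ y in ball z r, h y ∂μ := by
  simp only [maximalFunction, lt_iSup_iff, exists_prop]

lemma isOpen_lt_maximalFunction (h : E → ℝ≥0∞) (a : ℝ≥0∞) :
    IsOpen {x | a < maximalFunction μ h x} := by
  rw [isOpen_iff_forall_mem_open]
  intro x hx
  obtain ⟨z, r, hxz, ha⟩ := (lt_maximalFunction_iff μ).1 hx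
  exact ⟨ball z r, fun y hy => (lt_maximalFunction_iff μ).2 ⟨z, r, hy, ha⟩, isOpen_ball, hxz⟩

lemma measurable_maximalFunction [BorelSpace E] (h : E → ℝ≥0∞) : Measurable (maximalFunction μ h) :=
  measurable_of_Ioi fun a => (isOpen_lt_maximalFunction μ h a).measurableSet

lemma maximalFunction_add_const_le {h h₁ : E → ℝ≥0∞} {c : ℝ≥0∞} (hh : ∀ y, h y ≤ h₁ y + c)
    (x : E) : maximalFunction μ h x ≤ maximalFunction μ h₁ x + c := by
  refine iSup_le fun z => iSup_le fun r => iSup_le fun hx => ?_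
  refine le_trans ?_ (add_le_add_left (laverage_le_maximalFunction μ h₁ hx) c)
  simp only [laverage_eq, ENNReal.div_eq_inv_mul]
  calc _ ≤ (μ.restrict (ball z r) univ)⁻¹ * (∫⁻ y in ball z r, (h₁ y + c) ∂μ) := by
        gcongr with y; exact hh y
    _ ≤ _ := by
        rw [lintegral_add_right _ measurable_const, mul_add, lintegral_const]
        gcongr
        rw [mul_comm c, ← mul_assoc]
        exact mul_le_of_le_one_left' (ENNReal.inv_mul_le_one _)

variable [NormedSpace ℝ E] [FiniteDimensional ℝ E] [BorelSpace E] [μ.IsAddHaarMeasure]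
  [Nontrivial E]

/-- The weak type `(1, 1)` inequality for the maximal function. -/
lemma mul_measure_lt_maximalFunction_le (h : E → ℝ≥0∞) {a : ℝ≥0∞} (ha : a ≠ 0) (ha' : a ≠ ∞) :
    a * μ {x | a < maximalFunction μ h x} ≤ 5 ^ finrank ℝ E * ∫⁻ y, h y ∂μ := by
  rcases eq_or_ne (∫⁻ y, h y ∂μ) ∞ with hI | hI
  · rw [hI, ENNReal.mul_top (by positivity)]; exact le_top
  set d := finrank ℝ E with hd
  have hd0 : d ≠ 0 := (finrank_pos (R := ℝ) (M := E)).ne'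
  let t : Set (E × ℝ) := {b | 0 < b.2 ∧ a * μ (ball b.1 b.2) ≤ ∫⁻ y in ball b.1 b.2, h y ∂μ}
  have hv0 : μ (ball (0 : E) 1) ≠ 0 := (measure_ball_pos μ _ one_pos).ne'
  have hv1 : μ (ball (0 : E) 1) ≠ ∞ := measure_ball_lt_top.ne
  -- The Vitali covering needs bounded radii; they are bounded because `a * μ(ball)` is at most the
  -- finite integral of `h`.
  obtain ⟨R, hR⟩ : ∃ R : ℝ, ∀ b ∈ t, b.2 ≤ R := by
    set K := ((∫⁻ y, h y ∂μ) / (a * μ (ball (0 : E) 1))).toReal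
    refine ⟨max 1 K, fun b hb => ?_⟩
    rcases le_total b.2 1 with h1 | h1
    · exact h1.trans (le_max_left _ _)
    have h2 : ENNReal.ofReal (b.2 ^ d) ≤ (∫⁻ y, h y ∂μ) / (a * μ (ball (0 : E) 1)) := by
      rw [ENNReal.le_div_iff_mul_le (Or.inl (mul_ne_zero ha hv0))
        (Or.inl (ENNReal.mul_ne_top ha' hv1)), mul_left_comm, hd,
        ← Measure.addHaar_ball μ b.1 hb.1.le]
      exact hb.2.trans (setLIntegral_le_lintegral _ _)
    have h3 : b.2 ^ d ≤ K := (ENNReal.ofReal_le_iff_le_toReal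
      (ENNReal.div_ne_top hI (mul_ne_zero ha hv0))).1 h2
    exact ((le_self_pow₀ h1 hd0).trans h3).trans (le_max_right _ _)
  obtain ⟨u, hut, hdisj, hcov⟩ := Vitali.exists_disjoint_subfamily_covering_enlargement_ball
    t Prod.fst Prod.snd R hR 5 (by norm_num)
  have hcount : u.Countable := hdisj.countable_of_isOpen (fun _ _ => isOpen_ball)
    fun b hb => nonempty_ball.2 (hut hb).1
  have hsub : {x | a < maximalFunction μ h x} ⊆ ⋃ b ∈ u, ball b.1 (5 * b.2) := by
    intro x hx
    obtain ⟨z, r, hxz, hlt⟩ := (lt_maximalFunction_iff μ).1 hx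
    have hr : 0 < r := pos_of_mem_ball hxz
    have hmem : (z, r) ∈ t := by
      refine ⟨hr, ?_⟩
      rw [setLAverage_eq] at hlt
      exact (ENNReal.le_div_iff_mul_le (Or.inl (measure_ball_pos μ _ hr).ne')
        (Or.inl measure_ball_lt_top.ne)).1 hlt.le
    obtain ⟨b, hb, hsub⟩ := hcov _ hmem
    exact mem_biUnion hb (hsub hxz)
  calc a * μ {x | a < maximalFunction μ h x}
      ≤ a * ∑' b : u, μ (ball b.1.1 (5 * b.1.2)) := by
        gcongr; exact (measure_mono hsub).trans (measure_biUnion_le μ hcount _)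
    _ = 5 ^ d * ∑' b : u, a * μ (ball b.1.1 b.1.2) := by
        rw [← ENNReal.tsum_mul_left, ← ENNReal.tsum_mul_left]
        congr 1; ext b
        rw [Measure.addHaar_ball_mul_of_pos μ _ (by norm_num), Measure.addHaar_ball_center μ b.1.1]
        rw [ENNReal.ofReal_pow (by norm_num), ENNReal.ofReal_ofNat]
        ring
    _ ≤ 5 ^ d * ∑' b : u, ∫⁻ y in ball b.1.1 b.1.2, h y ∂μ := by
        gcongr with b; exact (hut b.2).2
    _ = 5 ^ d * ∫⁻ y in ⋃ b ∈ u, ball b.1 b.2, h y ∂μ := by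
        rw [lintegral_biUnion hcount (fun _ _ => measurableSet_ball) hdisj]
    _ ≤ _ := mul_le_mul_right (setLIntegral_le_lintegral _ _) _

/-- Discarding the values of `h` up to `a / 2` lowers the maximal function by at most `a / 2`, so
the weak type bound at height `a / 2` applies to what remains. -/
lemma mul_measure_lt_maximalFunction_le_setLIntegral {h : E → ℝ≥0∞} (hh : Measurable h)
    {a : ℝ≥0∞} (ha : a ≠ 0) (ha' : a ≠ ∞) :
    a * μ {x | a < maximalFunction μ h x} ≤
      2 * 5 ^ finrank ℝ E * ∫⁻ y in {y | a < 2 * h y}, h y ∂μ := by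
  have hS : MeasurableSet {y | a < 2 * h y} := measurableSet_lt measurable_const (hh.const_mul 2)
  have key := mul_measure_lt_maximalFunction_le μ ({y | a < 2 * h y}.indicator h)
    (a := a / 2) (by simpa using ha) (ENNReal.div_ne_top ha' (by norm_num))
  rw [lintegral_indicator hS] at key
  have hsub : {x | a < maximalFunction μ h x} ⊆
      {x | a / 2 < maximalFunction μ ({y | a < 2 * h y}.indicator h) x} := by
    intro x hx
    by_contra hcon
    have h1 : maximalFunction μ h x ≤
        maximalFunction μ ({y | a < 2 * h y}.indicator h) x + a / 2 := by
      refine maximalFunction_add_const_le μ (fun y => ?_) x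
      by_cases hy : a < 2 * h y
      · simp [indicator, hy]
      · rw [not_lt, mul_comm] at hy
        exact ((ENNReal.le_div_iff_mul_le (by simp) (by simp)).2 hy).trans le_add_self
    have h2 := h1.trans (add_le_add_left (not_lt.1 hcon) _)
    rw [ENNReal.add_halves] at h2
    exact absurd hx (not_lt.2 h2)
  calc a * μ {x | a < maximalFunction μ h x}
      = 2 * (a / 2 * μ {x | a < maximalFunction μ h x}) := by
        rw [← mul_assoc, ENNReal.mul_div_cancel (by simp) (by simp)]
    _ ≤ 2 * (5 ^ finrank ℝ E * ∫⁻ y in {y | a < 2 * h y}, h y ∂μ) := by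
        exact mul_le_mul_right ((mul_le_mul_right (measure_mono hsub) _).trans key) _
    _ = _ := by ring

/-- The strong type `(m, m)` inequality for the maximal function. -/
lemma lintegral_maximalFunction_rpow_le {m : ℝ} (hm : 1 < m) {h : E → ℝ≥0∞} (hh : Measurable h) :
    ∫⁻ x, maximalFunction μ h x ^ m ∂μ ≤
      ENNReal.ofReal (m / (m - 1) * 2 ^ m * 5 ^ finrank ℝ E) * ∫⁻ y, h y ^ m ∂μ := by
  have hm0 : 0 < m := by linarith
  have hm1 : 0 < m - 1 := by linarith
  rcases eq_or_ne (∫⁻ y, h y ^ m ∂μ) ∞ with hI | hI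
  · rw [hI, ENNReal.mul_top]
    · exact le_top
    · rw [Ne, ENNReal.ofReal_eq_zero, not_le]; positivity
  set M := maximalFunction μ h
  have hM : Measurable M := measurable_maximalFunction μ h
  -- With `ν = h dμ`, the weak type bound involves the `ν`-distribution function of `2h`. The
  -- layer-cake formula for `ν` with exponent `m - 1` then evaluates the integral over heights.
  set ν := μ.withDensity h
  have hfin : ∀ᵐ y ∂μ, h y ≠ ∞ := by
    filter_upwards [ae_lt_top (hh.pow_const m) hI] with y hy h'
    simp [h', hm0] at hy
  have hfinν : ∀ᵐ y ∂ν, h y ≠ ∞ := (withDensity_absolutelyContinuous μ h).ae_le hfin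
  have hlevel : ∀ t : ℝ, 0 < t → μ {x | ENNReal.ofReal t < M x} ≤
      2 * 5 ^ finrank ℝ E * ν {y | t < (2 * h y).toReal} * ENNReal.ofReal t⁻¹ := by
    intro t ht
    have h1 := mul_measure_lt_maximalFunction_le_setLIntegral μ hh (a := ENNReal.ofReal t)
      (by simpa using ht) (by simp)
    have h2 : ∫⁻ y in {y | ENNReal.ofReal t < 2 * h y}, h y ∂μ = ν {y | t < (2 * h y).toReal} := by
      rw [← withDensity_apply _ (measurableSet_lt measurable_const (hh.const_mul 2))]
      refine measure_congr ?_
      filter_upwards [hfinν] with y hy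
      refine propext ?_
      change ENNReal.ofReal t < 2 * h y ↔ t < (2 * h y).toReal
      rw [ENNReal.ofReal_lt_iff_lt_toReal ht.le (ENNReal.mul_ne_top (by simp) hy)]
    rw [h2, mul_comm] at h1
    rw [ENNReal.ofReal_inv_of_pos ht, ← div_eq_mul_inv]
    exact (ENNReal.le_div_iff_mul_le (by simp [ht]) (by simp)).2 h1
  have hpow : ∀ y, h y * (2 * h y) ^ (m - 1) = ENNReal.ofReal (2 ^ (m - 1)) * h y ^ m := by
    intro y
    rw [ENNReal.mul_rpow_of_nonneg _ _ hm1.le, mul_left_comm,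
      ← ENNReal.ofReal_rpow_of_pos (by norm_num), ENNReal.ofReal_ofNat]
    congr 1
    nth_rewrite 1 [← ENNReal.rpow_one (h y)]
    rw [← ENNReal.rpow_add_of_nonneg _ _ zero_le_one hm1.le, add_sub_cancel]
  -- The layer-cake formula is real-valued and `toReal` sends `∞` to `0`, so finiteness is needed.
  -- It follows from the level bound as `t → ∞`, with the `ν`-measure frozen at its value for `t =
  -- 1`.
  have hMfin : ∀ᵐ x ∂μ, M x ≠ ∞ := by
    have hD : ν {y | 1 < (2 * h y).toReal} ≠ ∞ := by
      have hS : MeasurableSet {y | 1 < (2 * h y).toReal} :=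
        measurableSet_lt measurable_const (hh.const_mul 2).ennreal_toReal
      refine ne_top_of_le_ne_top (b := ENNReal.ofReal (2 ^ (m - 1)) * ∫⁻ y, h y ^ m ∂μ)
        (ENNReal.mul_ne_top ENNReal.ofReal_ne_top hI) ?_
      rw [withDensity_apply _ hS, ← lintegral_const_mul _ (hh.pow_const m)]
      refine (setLIntegral_mono ((hh.pow_const m).const_mul _) fun y hy => ?_).trans
        (setLIntegral_le_lintegral _ _)
      rw [← hpow y]
      refine le_mul_of_one_le_right' (ENNReal.one_le_rpow ?_ hm1)
      by_contra hlt
      have := ENNReal.toReal_mono ENNReal.one_ne_top (not_le.1 hlt).le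
      exact absurd hy (by simpa using this)
    have hle : ∀ t : ℝ, 1 ≤ t → μ {x | M x = ∞} ≤
        2 * 5 ^ finrank ℝ E * ν {y | 1 < (2 * h y).toReal} * ENNReal.ofReal t⁻¹ := by
      intro t ht
      refine le_trans (measure_mono fun x (hx : M x = ∞) => ?_) ((hlevel t (by linarith)).trans ?_)
      · change _ < M x
        rw [hx]; exact ENNReal.ofReal_lt_top
      · gcongr
    have hlim : Filter.Tendsto (fun t : ℝ => 2 * 5 ^ finrank ℝ E *
        ν {y | 1 < (2 * h y).toReal} * ENNReal.ofReal t⁻¹) Filter.atTop (nhds 0) := by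
      have h1 := ENNReal.tendsto_ofReal (tendsto_inv_atTop_zero (𝕜 := ℝ))
      have hne : 2 * 5 ^ finrank ℝ E * ν {y | 1 < (2 * h y).toReal} ≠ ∞ := by finiteness
      have h2 := ENNReal.Tendsto.const_mul h1 (Or.inr hne)
      simpa using h2
    have h0 : μ {x | M x = ∞} ≤ 0 := ge_of_tendsto hlim
      ((Filter.eventually_ge_atTop 1).mono hle)
    simpa [ae_iff] using h0
  have hlc := lintegral_rpow_eq_lintegral_meas_lt_mul ν (f := fun y => (2 * h y).toReal)
    (Filter.Eventually.of_forall fun _ => ENNReal.toReal_nonneg)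
    (hh.const_mul 2).ennreal_toReal.aemeasurable hm1
  have hlν : ∫⁻ y, ENNReal.ofReal ((2 * h y).toReal ^ (m - 1)) ∂ν =
      ENNReal.ofReal (2 ^ (m - 1)) * ∫⁻ y, h y ^ m ∂μ := by
    rw [← lintegral_const_mul _ (hh.pow_const m)]
    calc _ = ∫⁻ y, (2 * h y) ^ (m - 1) ∂ν := by
          refine lintegral_congr_ae ?_
          filter_upwards [hfinν] with y hy
          rw [ENNReal.toReal_rpow, ENNReal.ofReal_toReal]
          exact ENNReal.rpow_ne_top_of_nonneg hm1.le (ENNReal.mul_ne_top (by simp) hy)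
      _ = ∫⁻ y, h y * (2 * h y) ^ (m - 1) ∂μ :=
          lintegral_withDensity_eq_lintegral_mul _ hh ((hh.const_mul 2).pow_const _)
      _ = _ := lintegral_congr hpow
  set J := ∫⁻ t in Ioi (0 : ℝ), ν {y | t < (2 * h y).toReal} * ENNReal.ofReal (t ^ (m - 1 - 1))
  have hJ : J = ENNReal.ofReal (m - 1)⁻¹ *
      (ENNReal.ofReal (2 ^ (m - 1)) * ∫⁻ y, h y ^ m ∂μ) := by
    rw [← hlν, hlc, ← mul_assoc, ← ENNReal.ofReal_mul (by positivity), inv_mul_cancel₀ hm1.ne',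
      ENNReal.ofReal_one, one_mul]
  calc ∫⁻ x, M x ^ m ∂μ = ∫⁻ x, ENNReal.ofReal ((M x).toReal ^ m) ∂μ := by
        refine lintegral_congr_ae ?_
        filter_upwards [hMfin] with y hy
        rw [ENNReal.toReal_rpow, ENNReal.ofReal_toReal]
        exact ENNReal.rpow_ne_top_of_nonneg hm0.le hy
    _ = ENNReal.ofReal m * ∫⁻ t in Ioi (0 : ℝ),
          μ {x | t < (M x).toReal} * ENNReal.ofReal (t ^ (m - 1)) :=
        lintegral_rpow_eq_lintegral_meas_lt_mul μ
          (Filter.Eventually.of_forall fun _ => ENNReal.toReal_nonneg)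
          hM.ennreal_toReal.aemeasurable hm0
    _ ≤ ENNReal.ofReal m * ∫⁻ t in Ioi (0 : ℝ), 2 * 5 ^ finrank ℝ E *
          (ν {y | t < (2 * h y).toReal} * ENNReal.ofReal (t ^ (m - 1 - 1))) := by
        gcongr ENNReal.ofReal m * ?_
        refine setLIntegral_mono' measurableSet_Ioi fun t (ht : 0 < t) => ?_
        have hsub : {x | t < (M x).toReal} ⊆ {x | ENNReal.ofReal t < M x} := fun x hx =>
          (ENNReal.ofReal_lt_iff_lt_toReal ht.le fun hx' => by
            simp [hx', ht.le.not_gt] at hx).2 hx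
        calc _ ≤ 2 * 5 ^ finrank ℝ E * ν {y | t < (2 * h y).toReal} * ENNReal.ofReal t⁻¹ *
              ENNReal.ofReal (t ^ (m - 1)) := by
              gcongr; exact (measure_mono hsub).trans (hlevel t ht)
          _ = _ := by
              rw [mul_assoc _ (ENNReal.ofReal _), ← ENNReal.ofReal_mul (by positivity),
                Real.rpow_sub_one ht.ne' (m - 1), mul_assoc, inv_mul_eq_div]
    _ = ENNReal.ofReal m * (2 * 5 ^ finrank ℝ E * J) := by
        rw [lintegral_const_mul' _ _ (by finiteness)]
    _ = _ := by
        have h2 : (2 : ℝ) ^ m = 2 * 2 ^ (m - 1) := by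
          rw [Real.rpow_sub_one (by norm_num)]; ring
        rw [hJ, h2, div_eq_mul_inv, ENNReal.ofReal_mul (by positivity),
          ENNReal.ofReal_mul (by positivity), ENNReal.ofReal_mul (by positivity),
          ENNReal.ofReal_mul (by positivity), ENNReal.ofReal_pow (by norm_num)]
        simp only [ENNReal.ofReal_ofNat]
        ring

end MaximalFunction

/-! ### Poincaré-type comparison of averages through the fractional gradient. -/

section Poincare

open Metric Set

lemma lintegral_le_rpow_lintegral_rpow {α : Type*} [MeasurableSpace α] (P : Measure α)
    [IsProbabilityMeasure P] {p : ℝ} (hp : 1 ≤ p) {f : α → ℝ≥0∞} (hf : AEMeasurable f P) :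
    ∫⁻ x, f x ∂P ≤ (∫⁻ x, f x ^ p ∂P) ^ (1 / p) := by
  have h := eLpNorm'_le_eLpNorm'_of_exponent_le (μ := P) (f := f) zero_lt_one hp
    hf.aestronglyMeasurable
  simpa [eLpNorm'] using h

lemma laverage_le_rpow_laverage_rpow {α : Type*} [MeasurableSpace α] (μ : Measure α)
    {A : Set α} (hA : μ A ≠ 0) (hA' : μ A ≠ ∞) {p : ℝ} (hp : 1 ≤ p) {f : α → ℝ≥0∞}
    (hf : Measurable f) :
    ⨍⁻ x in A, f x ∂μ ≤ (⨍⁻ x in A, f x ^ p ∂μ) ^ (1 / p) := by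
  have : NeZero (μ.restrict A) := ⟨by simpa using hA⟩
  have : IsFiniteMeasure (μ.restrict A) := ⟨by simpa [lt_top_iff_ne_top] using hA'⟩
  exact lintegral_le_rpow_lintegral_rpow _ hp hf.aemeasurable

lemma enorm_sub_average_le {α : Type*} [MeasurableSpace α] (μ : Measure α)
    {A : Set α} (hA : μ A ≠ 0) (hA' : μ A ≠ ∞) {u : α → ℂ}
    (hu : IntegrableOn u A μ) (c : ℂ) :
    ‖c - ⨍ x in A, u x ∂μ‖ₑ ≤ ⨍⁻ x in A, ‖c - u x‖ₑ ∂μ := by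
  have : NeZero (μ.restrict A) := ⟨by simpa using hA⟩
  have : IsFiniteMeasure (μ.restrict A) := ⟨by simpa [lt_top_iff_ne_top] using hA'⟩
  have h : c - ⨍ x in A, u x ∂μ = ⨍ x in A, (c - u x) ∂μ := by
    have h1 : Integrable u ((μ.restrict A univ)⁻¹ • μ.restrict A) := hu.to_average
    rw [average, average, integral_sub (integrable_const _) h1,
      integral_const, probReal_univ, one_smul]
  rw [h]
  exact enorm_integral_le_lintegral_enorm _

variable {n : ℕ}

local notation "𝔼" => EuclideanSpace ℝ (Fin n)

/-- The pointwise Gagliardo gradient, whose `L^p` norm is the Gagliardo seminorm. -/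
noncomputable def fracGradient (s p : ℝ) (u : 𝔼 → ℂ) (y : 𝔼) : ℝ≥0∞ :=
  (∫⁻ w, ‖u y - u w‖ₑ ^ p / ‖y - w‖ₑ ^ (s * p + n)) ^ (1 / p)

lemma measurable_fracGradient (s p : ℝ) {u : 𝔼 → ℂ} (hu : Measurable u) :
    Measurable (fracGradient s p u) := by
  unfold fracGradient
  refine Measurable.pow_const (Measurable.lintegral_prod_right' (f := fun z : 𝔼 × 𝔼 =>
    ‖u z.1 - u z.2‖ₑ ^ p / ‖z.1 - z.2‖ₑ ^ (s * p + n)) ?_) _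
  fun_prop

lemma rpow_lintegral_fracGradient {s p : ℝ} (hp : 0 < p) (u : 𝔼 → ℂ) :
    (∫⁻ y, fracGradient s p u y ^ p) ^ (1 / p) = gagliardoSeminorm s p u := by
  simp only [fracGradient, gagliardoSeminorm, ← ENNReal.rpow_mul, one_div_mul_cancel hp.ne',
    ENNReal.rpow_one]

/-- Average `|u(y) - u(w)|` over `A × B`, apply Jensen in `w`, and insert the kernel using `|y - w|
≤ D`. -/
lemma enorm_average_sub_average_le {s p : ℝ} (hs : 0 < s) (hp : 1 ≤ p) {u : 𝔼 → ℂ}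
    (hum : Measurable u) {A B : Set 𝔼} (hA : volume A ≠ 0) (hA' : volume A ≠ ∞)
    (hB : volume B ≠ 0) (hB' : volume B ≠ ∞) (hAm : MeasurableSet A) (hBm : MeasurableSet B)
    (huA : IntegrableOn u A) (huB : IntegrableOn u B) {D : ℝ≥0∞}
    (hD : ∀ y ∈ A, ∀ w ∈ B, ‖y - w‖ₑ ≤ D) :
    ‖(⨍ y in A, u y) - ⨍ w in B, u w‖ₑ ≤
      (D ^ (s * p + n) / volume B) ^ (1 / p) * ⨍⁻ y in A, fracGradient s p u y ∂volume := by
  have hp0 : 0 < p := by linarith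
  have he : 0 < s * p + n := by positivity
  rw [← enorm_neg, neg_sub]
  refine (enorm_sub_average_le volume hA hA' huA _).trans ?_
  have key : ∀ y ∈ A, ‖(⨍ w in B, u w) - u y‖ₑ ≤
      (D ^ (s * p + n) / volume B) ^ (1 / p) * fracGradient s p u y := by
    intro y hy
    rw [← enorm_neg, neg_sub]
    refine (enorm_sub_average_le volume hB hB' huB _).trans
      ((laverage_le_rpow_laverage_rpow volume hB hB' hp (by fun_prop)).trans ?_)
    rw [fracGradient, ← ENNReal.mul_rpow_of_nonneg _ _ (by positivity)]
    gcongr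
    rw [setLAverage_eq, ENNReal.div_eq_inv_mul, ENNReal.div_eq_inv_mul, mul_assoc]
    gcongr
    rw [← lintegral_const_mul _ (by fun_prop)]
    refine (setLIntegral_mono' hBm fun w hw => ?_).trans (setLIntegral_le_lintegral _ _)
    rcases eq_or_ne y w with rfl | hyw
    · simp [hp0]
    have h1 : ‖y - w‖ₑ ^ (s * p + n) ≠ 0 := by simp [sub_eq_zero, hyw, he.not_gt]
    have h2 : ‖y - w‖ₑ ^ (s * p + n) ≠ ∞ := by simp [he.not_gt]
    calc ‖u y - u w‖ₑ ^ p
        = ‖y - w‖ₑ ^ (s * p + n) * (‖u y - u w‖ₑ ^ p / ‖y - w‖ₑ ^ (s * p + n)) :=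
          (ENNReal.mul_div_cancel h1 h2).symm
      _ ≤ _ := by gcongr; exact hD y hy w hw
  rw [setLAverage_eq, setLAverage_eq, ← mul_div_assoc,
    ← lintegral_const_mul _ (measurable_fracGradient s p hum)]
  gcongr ?_ / _
  exact setLIntegral_mono' hAm key

/-- Here `D = 4ρ`, and `|B|^(-1/p)` cancels the `ρ^(n/p)` in `D^((sp+n)/p)`, leaving `ρ^s`. The
hypotheses cover both halving a radius and moving a centre. -/
lemma exists_enorm_average_sub_average_closedBall_le [NeZero n] {s p : ℝ} (hs : 0 < s)
    (hp : 1 ≤ p) :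
    ∃ C : ℝ, 0 < C ∧ ∀ u : 𝔼 → ℂ, Measurable u → LocallyIntegrable u →
      ∀ (a b : 𝔼) (ρ σ : ℝ), 0 < ρ → ρ ≤ 2 * σ → dist a b + ρ + σ ≤ 4 * ρ →
        ‖(⨍ y in closedBall a ρ, u y) - ⨍ w in closedBall b σ, u w‖ₑ ≤
          ENNReal.ofReal (C * ρ ^ s) * ⨍⁻ y in closedBall a ρ, fracGradient s p u y ∂volume := by
  have hp0 : 0 < p := by linarith
  have hv0 : volume (ball (0 : 𝔼) 1) ≠ 0 := (measure_ball_pos volume _ one_pos).ne'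
  have hv1 : volume (ball (0 : 𝔼) 1) ≠ ∞ := measure_ball_lt_top.ne
  set v := (volume (ball (0 : 𝔼) 1)).toReal with hv
  have hvpos : 0 < v := ENNReal.toReal_pos hv0 hv1
  refine ⟨(4 ^ (s * p + n) * 2 ^ n / v) ^ (1 / p), by positivity, ?_⟩
  intro u hum hui a b ρ σ hρ hρσ hdist
  have hσ : 0 < σ := by linarith
  refine (enorm_average_sub_average_le hs hp hum (D := ENNReal.ofReal (4 * ρ))
    (measure_closedBall_pos volume _ hρ).ne' measure_closedBall_lt_top.ne
    (measure_closedBall_pos volume _ hσ).ne' measure_closedBall_lt_top.ne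
    measurableSet_closedBall measurableSet_closedBall
    (hui.integrableOn_isCompact (isCompact_closedBall _ _))
    (hui.integrableOn_isCompact (isCompact_closedBall _ _)) ?_).trans ?_
  · intro y hy w hw
    rw [← ofReal_norm, ← dist_eq_norm]
    refine ENNReal.ofReal_le_ofReal (le_trans ?_ hdist)
    have h1 := dist_triangle4 y a b w
    have h2 := mem_closedBall.1 hy
    have h3 := mem_closedBall'.1 hw
    linarith
  gcongr
  rw [Measure.addHaar_closedBall _ _ hσ.le, finrank_euclideanSpace_fin,
    ← ENNReal.ofReal_toReal hv1, ← hv, ← ENNReal.ofReal_mul (by positivity),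
    ENNReal.ofReal_rpow_of_pos (by positivity), ← ENNReal.ofReal_div_of_pos (by positivity),
    ENNReal.ofReal_rpow_of_pos (by positivity)]
  refine ENNReal.ofReal_le_ofReal ?_
  have h1 : ρ ^ s = ((ρ ^ (s * p))) ^ (1 / p) := by
    rw [← Real.rpow_mul hρ.le]; congr 1; field_simp
  rw [h1, ← Real.mul_rpow (by positivity) (by positivity)]
  gcongr
  rw [div_mul_eq_mul_div, div_le_div_iff₀ (by positivity) hvpos,
    Real.mul_rpow (by norm_num) hρ.le, Real.rpow_add hρ, Real.rpow_natCast ρ n]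
  have h2 : ρ ^ n ≤ 2 ^ n * σ ^ n := by rw [← mul_pow]; gcongr
  calc _ = 4 ^ (s * p + n) * ρ ^ (s * p) * v * ρ ^ n := by ring
    _ ≤ 4 ^ (s * p + n) * ρ ^ (s * p) * v * (2 ^ n * σ ^ n) := by gcongr
    _ = _ := by ring

lemma enorm_sub_le_sum_of_enorm_sub_succ_le {f : ℕ → ℂ} {b : ℕ → ℝ≥0∞}
    (h : ∀ k, ‖f k - f (k + 1)‖ₑ ≤ b k) (K : ℕ) :
    ‖f 0 - f K‖ₑ ≤ ∑ k ∈ Finset.range K, b k := by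
  simpa only [edist_eq_enorm_sub] using
    (edist_le_range_sum_edist f K).trans (Finset.sum_le_sum fun k _ => by
      rw [edist_eq_enorm_sub]; exact h k)

end Poincare

/-! ### Hedberg-type interpolation between the maximal function and the `L^p` norm. -/

section Hedberg

open Metric Set

variable {n : ℕ}

local notation "𝔼" => EuclideanSpace ℝ (Fin n)

/-- Hedberg's interpolation of the maximal function of `g ^ t` with the `L^p` norm of `g`. -/
noncomputable def hedbergMajorant (t p q : ℝ) (g : 𝔼 → ℝ≥0∞) (x : 𝔼) : ℝ≥0∞ :=
  maximalFunction volume (fun y => g y ^ t) x ^ (p / (t * q)) *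
    (∫⁻ y, g y ^ p) ^ (1 / p - 1 / q)

lemma exists_lintegral_hedbergMajorant_le [NeZero n] {t p q : ℝ} (ht : 1 ≤ t) (htp : t < p)
    (hpq : p < q) :
    ∃ C : ℝ, 0 < C ∧ ∀ g : 𝔼 → ℝ≥0∞, Measurable g →
      (∫⁻ x, hedbergMajorant t p q g x ^ q) ^ (1 / q) ≤
        ENNReal.ofReal C * (∫⁻ y, g y ^ p) ^ (1 / p) := by
  have ht0 : 0 < t := by linarith
  have hp0 : 0 < p := by linarith
  have hq0 : 0 < q := by linarith
  have hm : 1 < p / t := (one_lt_div ht0).2 htp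
  have hδ : 0 < 1 / p - 1 / q := sub_pos.2 (one_div_lt_one_div_of_lt hp0 hpq)
  have hm1 : 0 < p / t - 1 := by linarith
  set C := p / t / (p / t - 1) * 2 ^ (p / t) * 5 ^ Module.finrank ℝ 𝔼 with hC
  have hCpos : 0 < C := by positivity
  refine ⟨C ^ (1 / q), by positivity, fun g hg => ?_⟩
  set I := ∫⁻ y, g y ^ p
  have hMm : Measurable (maximalFunction volume (fun y => g y ^ t)) :=
    measurable_maximalFunction _ _
  have hmax := lintegral_maximalFunction_rpow_le (volume : Measure 𝔼) hm (hg.pow_const t)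
  have hI : ∫⁻ y, (g y ^ t) ^ (p / t) = I := by
    refine lintegral_congr fun y => ?_
    rw [← ENNReal.rpow_mul, mul_div_cancel₀ _ ht0.ne']
  rw [hI] at hmax
  have hint : ∫⁻ x, hedbergMajorant t p q g x ^ q =
      (∫⁻ x, maximalFunction volume (fun y => g y ^ t) x ^ (p / t)) *
        I ^ ((1 / p - 1 / q) * q) := by
    rw [← lintegral_mul_const _ (hMm.pow_const _)]
    refine lintegral_congr fun x => ?_
    rw [hedbergMajorant, ENNReal.mul_rpow_of_nonneg _ _ hq0.le, ← ENNReal.rpow_mul,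
      ← ENNReal.rpow_mul]
    congr 2
    field_simp
  rw [hint, ← ENNReal.ofReal_rpow_of_pos hCpos]
  calc _ ≤ (ENNReal.ofReal C * I * I ^ ((1 / p - 1 / q) * q)) ^ (1 / q) := by gcongr
    _ = _ := by
      rw [mul_assoc, ENNReal.mul_rpow_of_nonneg _ _ (by positivity)]
      congr 1
      nth_rewrite 1 [← ENNReal.rpow_one I]
      rw [← ENNReal.rpow_add_of_nonneg _ _ zero_le_one (by positivity), ← ENNReal.rpow_mul]
      congr 1
      field_simp
      ring

lemma laverage_closedBall_le_maximalFunction [NeZero n] (h : 𝔼 → ℝ≥0∞) {a x : 𝔼} {ρ : ℝ}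
    (hρ : 0 < ρ) (hx : x ∈ closedBall a ρ) :
    ⨍⁻ y in closedBall a ρ, h y ∂volume ≤ 2 ^ n * maximalFunction volume h x := by
  have hxb : x ∈ ball a (2 * ρ) := closedBall_subset_ball (by linarith) hx
  refine le_trans ?_ (mul_le_mul_right (laverage_le_maximalFunction volume h hxb) _)
  have hvol : volume (ball a (2 * ρ)) = 2 ^ n * volume (closedBall a ρ) := by
    rw [Measure.addHaar_closedBall_eq_addHaar_ball, Measure.addHaar_ball_mul_of_pos _ _ two_pos,
      Measure.addHaar_ball_center _ a, finrank_euclideanSpace_fin, ENNReal.ofReal_pow (by norm_num),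
      ENNReal.ofReal_ofNat]
  rw [setLAverage_eq, setLAverage_eq, hvol, ← mul_div_assoc,
    ENNReal.mul_div_mul_left _ _ (by positivity) (by finiteness)]
  gcongr
  exact closedBall_subset_ball (by linarith)

/-- Split the power `1/t` of the mean: the part `p/(tq)` is bounded by the maximal function, the
rest by Hölder against `‖g‖_p`, where the volume yields the power of `ρ`. Being uncentred, the bound
holds at every `x` of the ball. -/
lemma exists_rpow_laverage_closedBall_le [NeZero n] {t p q : ℝ} (ht : 1 ≤ t) (htp : t < p)
    (hpq : p < q) :
    ∃ C : ℝ, 0 < C ∧ ∀ g : 𝔼 → ℝ≥0∞, Measurable g →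
      ∀ (a x : 𝔼) (ρ : ℝ), 0 < ρ → x ∈ closedBall a ρ →
        (⨍⁻ y in closedBall a ρ, g y ^ t ∂volume) ^ (1 / t) ≤
          ENNReal.ofReal (C * ρ ^ (-(n * (1 / p - 1 / q)))) * hedbergMajorant t p q g x := by
  have ht0 : 0 < t := by linarith
  have hp0 : 0 < p := by linarith
  have hq0 : 0 < q := by linarith
  have hδ : 0 < 1 / p - 1 / q := sub_pos.2 (one_div_lt_one_div_of_lt hp0 hpq)
  have hv0 : volume (ball (0 : 𝔼) 1) ≠ 0 := (measure_ball_pos volume _ one_pos).ne'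
  have hv1 : volume (ball (0 : 𝔼) 1) ≠ ∞ := measure_ball_lt_top.ne
  set v := (volume (ball (0 : 𝔼) 1)).toReal with hv
  have hvpos : 0 < v := ENNReal.toReal_pos hv0 hv1
  refine ⟨(2 ^ n) ^ (p / (t * q)) * v ^ (-(1 / p - 1 / q)), by positivity, ?_⟩
  intro g hg a x ρ hρ hx
  have hB0 : volume (closedBall a ρ) ≠ 0 := (measure_closedBall_pos volume _ hρ).ne'
  have hB1 : volume (closedBall a ρ) ≠ ∞ := measure_closedBall_lt_top.ne
  set A := ⨍⁻ y in closedBall a ρ, g y ^ t ∂volume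
  set I := ∫⁻ y, g y ^ p
  have h1 : A ≤ 2 ^ n * maximalFunction volume (fun y => g y ^ t) x :=
    laverage_closedBall_le_maximalFunction _ hρ hx
  have h2 : A ≤ ((volume (closedBall a ρ))⁻¹ * I) ^ (t / p) := by
    have h3 := laverage_le_rpow_laverage_rpow volume hB0 hB1 ((one_lt_div ht0).2 htp).le
      (hg.pow_const t)
    simp only [← ENNReal.rpow_mul, mul_div_cancel₀ _ ht0.ne', one_div_div] at h3
    refine h3.trans ?_
    gcongr
    rw [setLAverage_eq, ENNReal.div_eq_inv_mul]
    exact mul_le_mul_right (setLIntegral_le_lintegral _ _) _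
  have hvol : volume (closedBall a ρ) = ENNReal.ofReal (v * ρ ^ n) := by
    rw [Measure.addHaar_closedBall _ _ hρ.le, finrank_euclideanSpace_fin,
      ← ENNReal.ofReal_toReal hv1, ← hv, ← ENNReal.ofReal_mul (by positivity), mul_comm]
  have hsplit : 1 / t = p / (t * q) + (1 / t - p / (t * q)) := by ring
  have he : 0 ≤ 1 / t - p / (t * q) := by
    have : 1 / t - p / (t * q) = p / t * (1 / p - 1 / q) := by field_simp
    rw [this]; positivity
  calc A ^ (1 / t) = A ^ (p / (t * q)) * A ^ (1 / t - p / (t * q)) := by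
        nth_rewrite 1 [hsplit]
        exact ENNReal.rpow_add_of_nonneg _ _ (by positivity) he
    _ ≤ (2 ^ n * maximalFunction volume (fun y => g y ^ t) x) ^ (p / (t * q)) *
        (((volume (closedBall a ρ))⁻¹ * I) ^ (t / p)) ^ (1 / t - p / (t * q)) := by gcongr
    _ = _ := by
        have h5 : ENNReal.ofReal ((2 ^ n) ^ (p / (t * q))) = (2 ^ n) ^ (p / (t * q)) := by
          rw [← ENNReal.ofReal_rpow_of_pos (by positivity), ENNReal.ofReal_pow (by norm_num),
            ENNReal.ofReal_ofNat]
        have h4 : t / p * (1 / t - p / (t * q)) = 1 / p - 1 / q := by field_simp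
        rw [← ENNReal.rpow_mul, h4, ENNReal.mul_rpow_of_nonneg _ _ (by positivity),
          ENNReal.mul_rpow_of_nonneg _ _ hδ.le, hvol, ENNReal.inv_rpow, ← ENNReal.rpow_neg,
          ENNReal.ofReal_rpow_of_pos (by positivity), Real.mul_rpow hvpos.le (by positivity),
          ← Real.rpow_natCast ρ n, ← Real.rpow_mul hρ.le, mul_neg, hedbergMajorant,
          mul_assoc (_ ^ _) (v ^ _), ENNReal.ofReal_mul (by positivity),
          ENNReal.ofReal_mul (by positivity), h5, ENNReal.ofReal_mul (by positivity)]
        ring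

end Hedberg

/-! ### The pointwise estimate by chains of balls. -/

section Pointwise

open Metric Set Filter Topology

variable {n : ℕ}

local notation "𝔼" => EuclideanSpace ℝ (Fin n)

lemma rpow_div_two_pow {r : ℝ} (hr : 0 < r) (β : ℝ) (k : ℕ) :
    (r / 2 ^ k) ^ β = r ^ β * ((2 ^ β)⁻¹) ^ k := by
  rw [Real.div_rpow hr.le (by positivity), div_eq_mul_inv, inv_pow, ← Real.rpow_natCast 2 k,
    ← Real.rpow_natCast (2 ^ β) k, ← Real.rpow_mul (by norm_num), ← Real.rpow_mul (by norm_num),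
    mul_comm β]

/-- Averages over comparable balls: the displacement is controlled at a point of the first ball. -/
lemma exists_enorm_average_sub_average_le_hedbergMajorant [NeZero n] {s t p q : ℝ} (hs : 0 < s)
    (ht : 1 ≤ t) (htp : t < p) (hpq : p < q) :
    ∃ C : ℝ, 0 < C ∧ ∀ u : 𝔼 → ℂ, Measurable u → LocallyIntegrable u →
      ∀ (x a b : 𝔼) (ρ σ : ℝ), 0 < ρ → ρ ≤ 2 * σ → dist a b + ρ + σ ≤ 4 * ρ →
        x ∈ closedBall a ρ →
        ‖(⨍ y in closedBall a ρ, u y) - ⨍ w in closedBall b σ, u w‖ₑ ≤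
          ENNReal.ofReal (C * ρ ^ (s - n * (1 / p - 1 / q))) *
            hedbergMajorant t p q (fracGradient s p u) x := by
  obtain ⟨C₁, hC₁, h₁⟩ := exists_enorm_average_sub_average_closedBall_le (n := n) hs
    (ht.trans htp.le)
  obtain ⟨C₂, hC₂, h₂⟩ := exists_rpow_laverage_closedBall_le (n := n) ht htp hpq
  refine ⟨C₁ * C₂, by positivity, fun u hum hui x a b ρ σ hρ hρσ hdist hx => ?_⟩
  have hg := measurable_fracGradient s p hum
  refine (h₁ u hum hui a b ρ σ hρ hρσ hdist).trans ?_
  refine (mul_le_mul_right ((laverage_le_rpow_laverage_rpow volume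
    (measure_closedBall_pos volume _ hρ).ne' measure_closedBall_lt_top.ne ht hg).trans
    (h₂ _ hg a x ρ hρ hx)) _).trans_eq ?_
  rw [← mul_assoc, ← ENNReal.ofReal_mul (by positivity), sub_eq_add_neg s, Real.rpow_add hρ]
  congr 2
  ring

/-- Telescope over concentric balls of halved radii, with Lebesgue differentiation in the limit; `α
> 0` makes the series converge. -/
lemma exists_ae_enorm_sub_average_le [NeZero n] {s t p q : ℝ} (hs : 0 < s)
    (ht : 1 ≤ t) (htp : t < p) (hpq : p < q) (hα : 0 < s - n * (1 / p - 1 / q)) :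
    ∃ C : ℝ, 0 < C ∧ ∀ u : 𝔼 → ℂ, Measurable u → LocallyIntegrable u →
      ∀ᵐ x, ∀ r : ℝ, 0 < r →
        ‖u x - ⨍ y in closedBall x r, u y‖ₑ ≤
          ENNReal.ofReal (C * r ^ (s - n * (1 / p - 1 / q))) *
            hedbergMajorant t p q (fracGradient s p u) x := by
  obtain ⟨C, hC, h⟩ := exists_enorm_average_sub_average_le_hedbergMajorant (n := n) hs ht htp hpq
  set α := s - n * (1 / p - 1 / q)
  have hθ0 : 0 ≤ ((2 : ℝ) ^ α)⁻¹ := by positivity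
  have hθ1 : ((2 : ℝ) ^ α)⁻¹ < 1 := inv_lt_one_of_one_lt₀ (Real.one_lt_rpow (by norm_num) hα)
  set θ := ((2 : ℝ) ^ α)⁻¹
  have h1θ : 0 < 1 - θ := by linarith
  refine ⟨C * (1 - θ)⁻¹, by positivity, fun u hum hui => ?_⟩
  filter_upwards [IsUnifLocDoublingMeasure.ae_tendsto_average volume hui 1] with x hx r hr
  set Ψ := hedbergMajorant t p q (fracGradient s p u) x
  set f : ℕ → ℂ := fun k => ⨍ y in closedBall x (r / 2 ^ k), u y with hf
  have hlim : Tendsto f atTop (𝓝 (u x)) := by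
    refine hx (fun _ => x) (fun k => r / 2 ^ k) ?_ (Eventually.of_forall fun k => ?_)
    · refine tendsto_nhdsWithin_iff.2 ⟨?_, Eventually.of_forall fun k => ?_⟩
      · exact tendsto_const_nhds.div_atTop (tendsto_pow_atTop_atTop_of_one_lt one_lt_two)
      · exact mem_Ioi.2 (by positivity)
    · exact mem_closedBall_self (by positivity)
  have hstep : ∀ k, ‖f k - f (k + 1)‖ₑ ≤ ENNReal.ofReal (C * r ^ α * θ ^ k) * Ψ := by
    intro k
    have hk : (0 : ℝ) < r / 2 ^ k := by positivity
    have hk' : r / 2 ^ (k + 1) = r / 2 ^ k / 2 := by rw [pow_succ, div_div]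
    have := h u hum hui x x x (r / 2 ^ k) (r / 2 ^ (k + 1)) hk (by rw [hk']; linarith)
      (by rw [hk', dist_self]; linarith) (mem_closedBall_self hk.le)
    rwa [rpow_div_two_pow hr, ← mul_assoc] at this
  have hsum : ∀ K, ‖f 0 - f K‖ₑ ≤ ENNReal.ofReal (C * (1 - θ)⁻¹ * r ^ α) * Ψ := by
    intro K
    refine (enorm_sub_le_sum_of_enorm_sub_succ_le hstep K).trans ?_
    rw [← Finset.sum_mul, ← ENNReal.ofReal_sum_of_nonneg (fun k _ => by positivity),
      ← Finset.mul_sum]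
    gcongr ENNReal.ofReal ?_ * _
    have hgeo : ∑ k ∈ Finset.range K, θ ^ k ≤ (1 - θ)⁻¹ := by
      rw [← tsum_geometric_of_lt_one hθ0 hθ1]
      exact (summable_geometric_of_lt_one hθ0 hθ1).sum_le_tsum _ fun k _ => by positivity
    calc _ ≤ C * r ^ α * (1 - θ)⁻¹ := by gcongr
      _ = _ := by ring
  have hf0 : f 0 = ⨍ y in closedBall x r, u y := by simp [hf]
  rw [← hf0, ← enorm_neg, neg_sub]
  exact le_of_tendsto (tendsto_const_nhds.sub hlim).enorm (Eventually.of_forall hsum)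

lemma laverage_closedBall_div_two_pow_le [NeZero n] (h : 𝔼 → ℝ≥0∞) (z : 𝔼) {r : ℝ} (hr : 0 < r)
    (k : ℕ) :
    ⨍⁻ y in closedBall z (r / 2 ^ k), h y ∂volume ≤
      ENNReal.ofReal (2 ^ (k * n)) * ⨍⁻ y in closedBall z r, h y ∂volume := by
  have hvol : volume (closedBall z r) =
      ENNReal.ofReal (2 ^ (k * n)) * volume (closedBall z (r / 2 ^ k)) := by
    rw [Measure.addHaar_closedBall _ _ hr.le, Measure.addHaar_closedBall _ _ (by positivity),
      finrank_euclideanSpace_fin, ← mul_assoc, ← ENNReal.ofReal_mul (by positivity), div_pow,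
      ← pow_mul, mul_div_cancel₀ _ (by positivity)]
  rw [setLAverage_eq, setLAverage_eq, hvol, ← mul_div_assoc,
    ENNReal.mul_div_mul_left _ _ (by simp) (by simp)]
  gcongr
  exact div_le_self hr.le (one_le_pow₀ one_le_two)

/-- The small balls about `z` need not contain `x`, so the mean of `g^t` is first enlarged to the
full ball, costing `2^(kn/t)` after the root. Against the gain `2^(-ks)`, step `k` is at most a
multiple of `2^(ke)`, and since `e > 0` the sum is comparable to `2^(Ke)`. -/
lemma exists_enorm_average_sub_average_shrink_le [NeZero n] {s t p q e : ℝ} (hs : 0 < s)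
    (ht : 1 ≤ t) (htp : t < p) (hpq : p < q) (he : 0 < e) (hte : n / t - s ≤ e) :
    ∃ C : ℝ, 0 < C ∧ ∀ u : 𝔼 → ℂ, Measurable u → LocallyIntegrable u →
      ∀ (x z : 𝔼) (r : ℝ), 0 < r → x ∈ closedBall z r → ∀ K : ℕ,
        ‖(⨍ y in closedBall z r, u y) - ⨍ y in closedBall z (r / 2 ^ K), u y‖ₑ ≤
          ENNReal.ofReal (C * (2 ^ K) ^ e * r ^ (s - n * (1 / p - 1 / q))) *
            hedbergMajorant t p q (fracGradient s p u) x := by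
  have ht0 : 0 < t := by linarith
  obtain ⟨C₁, hC₁, h₁⟩ := exists_enorm_average_sub_average_closedBall_le (n := n) hs
    (ht.trans htp.le)
  obtain ⟨C₂, hC₂, h₂⟩ := exists_rpow_laverage_closedBall_le (n := n) ht htp hpq
  have hθ1 : 1 < (2 : ℝ) ^ e := Real.one_lt_rpow (by norm_num) he
  set θ := (2 : ℝ) ^ e with hθ
  have h1θ : 0 < θ - 1 := by linarith
  refine ⟨C₁ * C₂ * (θ - 1)⁻¹, by positivity, fun u hum hui x z r hr hx K => ?_⟩
  have hg := measurable_fracGradient s p hum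
  set g := fracGradient s p u
  set Ψ := hedbergMajorant t p q g x
  set α := s - n * (1 / p - 1 / q) with hα
  set f : ℕ → ℂ := fun k => ⨍ y in closedBall z (r / 2 ^ k), u y with hf
  have hstep : ∀ k, ‖f k - f (k + 1)‖ₑ ≤ ENNReal.ofReal (C₁ * C₂ * r ^ α * θ ^ k) * Ψ := by
    intro k
    have hk : (0 : ℝ) < r / 2 ^ k := by positivity
    have hk' : r / 2 ^ (k + 1) = r / 2 ^ k / 2 := by rw [pow_succ, div_div]
    have hlav : ⨍⁻ y in closedBall z (r / 2 ^ k), g y ∂volume ≤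
        ENNReal.ofReal ((2 ^ (k * n)) ^ (1 / t) * (C₂ * r ^ (-(n * (1 / p - 1 / q))))) * Ψ := by
      refine (laverage_le_rpow_laverage_rpow volume (measure_closedBall_pos volume _ hk).ne'
        measure_closedBall_lt_top.ne ht hg).trans ?_
      rw [ENNReal.ofReal_mul (by positivity), ← ENNReal.ofReal_rpow_of_pos (by positivity),
        mul_assoc]
      refine le_trans ?_ (mul_le_mul_right (h₂ g hg z x r hr hx) _)
      rw [← ENNReal.mul_rpow_of_nonneg _ _ (by positivity)]
      gcongr
      exact laverage_closedBall_div_two_pow_le _ z hr k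
    refine (h₁ u hum hui z z _ _ hk (by rw [hk']; linarith)
      (by rw [hk', dist_self]; linarith)).trans ((mul_le_mul_right hlav _).trans ?_)
    rw [← mul_assoc, ← ENNReal.ofReal_mul (by positivity)]
    gcongr ENNReal.ofReal ?_ * _
    have hexp : ((2 : ℝ) ^ s)⁻¹ ^ k * (2 ^ (k * n)) ^ (1 / t) ≤ θ ^ k := by
      have h3 : ((2 : ℝ) ^ (k * n)) ^ (1 / t) = (2 ^ ((n : ℝ) / t)) ^ k := by
        rw [← Real.rpow_natCast, ← Real.rpow_natCast, ← Real.rpow_mul (by norm_num),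
          ← Real.rpow_mul (by norm_num)]
        congr 1
        push_cast
        ring
      rw [h3, ← mul_pow, ← Real.rpow_neg (by norm_num), ← Real.rpow_add (by norm_num), hθ]
      gcongr
      · norm_num
      · linarith
    rw [rpow_div_two_pow hr, hα, sub_eq_add_neg s, Real.rpow_add hr]
    calc _ = C₁ * C₂ * (r ^ s * r ^ (-(n * (1 / p - 1 / q)))) *
          (((2 : ℝ) ^ s)⁻¹ ^ k * (2 ^ (k * n)) ^ (1 / t)) := by ring
      _ ≤ _ := by gcongr
  have hf0 : f 0 = ⨍ y in closedBall z r, u y := by simp [hf]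
  rw [← hf0]
  refine (enorm_sub_le_sum_of_enorm_sub_succ_le hstep K).trans ?_
  rw [← Finset.sum_mul, ← ENNReal.ofReal_sum_of_nonneg (fun k _ => by positivity),
    ← Finset.mul_sum]
  gcongr ENNReal.ofReal ?_ * _
  have hθK : ((2 : ℝ) ^ K) ^ e = θ ^ K := by
    rw [hθ, ← Real.rpow_natCast, ← Real.rpow_natCast, ← Real.rpow_mul (by norm_num),
      ← Real.rpow_mul (by norm_num), mul_comm]
  have hgeo : ∑ k ∈ Finset.range K, θ ^ k ≤ (θ - 1)⁻¹ * θ ^ K := by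
    rw [geom_sum_eq hθ1.ne', div_eq_inv_mul]
    gcongr
    linarith
  rw [hθK]
  calc _ ≤ C₁ * C₂ * r ^ α * ((θ - 1)⁻¹ * θ ^ K) := by gcongr
    _ = _ := by ring

lemma exists_ae_enorm_le_of_ae_eq_zero_on_ball [NeZero n] {s t p q e : ℝ} (hs : 0 < s)
    (ht : 1 ≤ t) (htp : t < p) (hpq : p < q) (hα : 0 < s - n * (1 / p - 1 / q))
    (he : 0 < e) (hte : n / t - s ≤ e) :
    ∃ C : ℝ, 0 < C ∧ ∀ u : 𝔼 → ℂ, Measurable u → LocallyIntegrable u →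
      ∀ᵐ x, ∀ (z : 𝔼) (d η : ℝ), 0 < d → 1 ≤ η → dist x z ≤ 2 * d →
        (∀ᵐ y, y ∈ ball z (d / η) → u y = 0) →
        ‖u x‖ₑ ≤ ENNReal.ofReal (C * η ^ e * d ^ (s - n * (1 / p - 1 / q))) *
          hedbergMajorant t p q (fracGradient s p u) x := by
  obtain ⟨C₁, hC₁, h₁⟩ := exists_ae_enorm_sub_average_le (n := n) hs ht htp hpq hα
  obtain ⟨C₂, hC₂, h₂⟩ :=
    exists_enorm_average_sub_average_le_hedbergMajorant (n := n) hs ht htp hpq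
  obtain ⟨C₃, hC₃, h₃⟩ :=
    exists_enorm_average_sub_average_shrink_le (n := n) hs ht htp hpq he hte
  set α := s - n * (1 / p - 1 / q)
  refine ⟨(C₁ + C₂ + C₃ * 4 ^ e) * 2 ^ α, by positivity, fun u hum hui => ?_⟩
  filter_upwards [h₁ u hum hui] with x hx z d η hd hη hxz hzero
  have hη0 : 0 < η := by linarith
  set Ψ := hedbergMajorant t p q (fracGradient s p u) x
  have hr : 0 < 2 * d := by positivity
  -- With `2^k ≤ 2η < 2^(k+1)`, the last ball has radius below `d/η`, while `2^(k+1) ≤ 4η` keeps the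
  -- loss at `(4η)^e`.
  obtain ⟨k, hk, hk'⟩ := exists_nat_pow_near (show (1 : ℝ) ≤ 2 * η by linarith) one_lt_two
  have hpow : (2 : ℝ) ^ (k + 1) ≤ 4 * η := by rw [pow_succ]; linarith
  have hsmall : 2 * d / 2 ^ (k + 1) < d / η := by
    rw [div_lt_div_iff₀ (by positivity) hη0]
    nlinarith
  have hav : ⨍ y in closedBall z (2 * d / 2 ^ (k + 1)), u y = 0 := by
    have h0 : ∀ᵐ y ∂volume.restrict (closedBall z (2 * d / 2 ^ (k + 1))), u y = 0 := by
      rw [ae_restrict_iff' measurableSet_closedBall]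
      filter_upwards [hzero] with y hy hyz
      exact hy (closedBall_subset_ball hsmall hyz)
    rw [average_congr (g := fun _ => (0 : ℂ)) h0, average_zero]
  have e₁ := hx (2 * d) hr
  have e₂ := h₂ u hum hui x x z (2 * d) (2 * d) hr (by linarith) (by linarith)
    (mem_closedBall_self hr.le)
  have e₃ := h₃ u hum hui x z (2 * d) hr hxz (k + 1)
  rw [hav, sub_zero] at e₃
  have e₃' : ‖⨍ y in closedBall z (2 * d), u y‖ₑ ≤
      ENNReal.ofReal (C₃ * (4 * η) ^ e * (2 * d) ^ α) * Ψ := e₃.trans (by gcongr)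
  set a := ⨍ y in closedBall x (2 * d), u y
  set b := ⨍ y in closedBall z (2 * d), u y
  calc ‖u x‖ₑ = ‖(u x - a) + (a - b) + b‖ₑ := by congr 1; ring
    _ ≤ ‖u x - a‖ₑ + ‖a - b‖ₑ + ‖b‖ₑ := enorm_add₃_le
    _ ≤ _ := add_le_add (add_le_add e₁ e₂) e₃'
    _ = ENNReal.ofReal (C₁ * (2 * d) ^ α + C₂ * (2 * d) ^ α + C₃ * (4 * η) ^ e * (2 * d) ^ α) *
          Ψ := by
        rw [ENNReal.ofReal_add (by positivity) (by positivity),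
          ENNReal.ofReal_add (by positivity) (by positivity), add_mul, add_mul]
    _ ≤ _ := by
        gcongr ENNReal.ofReal ?_ * _
        have h1 : 1 ≤ η ^ e := Real.one_le_rpow hη he.le
        rw [Real.mul_rpow (by norm_num) hη0.le, Real.mul_rpow (by norm_num) hd.le]
        calc _ ≤ (C₁ * η ^ e) * (2 ^ α * d ^ α) + (C₂ * η ^ e) * (2 ^ α * d ^ α) +
              C₃ * (4 ^ e * η ^ e) * (2 ^ α * d ^ α) := by
              gcongr
              · exact le_mul_of_one_le_right hC₁.le h1
              · exact le_mul_of_one_le_right hC₂.le h1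
          _ = _ := by ring

end Pointwise

/-! ### Geometry of plump complements and the conclusion. -/

lemma gagliardoSeminorm_congr_ae {n : ℕ} {s p : ℝ} {u v : EuclideanSpace ℝ (Fin n) → ℂ}
    (h : u =ᵐ[volume] v) : gagliardoSeminorm s p u = gagliardoSeminorm s p v := by
  unfold gagliardoSeminorm
  congr 1
  refine lintegral_congr_ae ?_
  filter_upwards [h] with x hx
  refine lintegral_congr_ae ?_
  filter_upwards [h] with y hy
  rw [hx, hy]

lemma not_isBounded_compl {n : ℕ} [NeZero n] {Ω : Set (EuclideanSpace ℝ (Fin n))}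
    (hΩ : Bornology.IsBounded Ω) : ¬ Bornology.IsBounded Ωᶜ := fun h =>
  NormedSpace.unbounded_univ ℝ (EuclideanSpace ℝ (Fin n)) (by
    rw [← Set.union_compl_self Ω]; exact hΩ.union h)

/-- Plumpness of the complement gives, for each point of `Ω`, a comparably near ball outside
`closure Ω`. -/
lemma IsPlump.exists_ball_disjoint_closure {n : ℕ} [NeZero n] {η : ℝ}
    {Ω : Set (EuclideanSpace ℝ (Fin n))} (hplump : IsPlump η Ωᶜ) (hΩo : IsOpen Ω)
    (hΩb : Bornology.IsBounded Ω) {x : EuclideanSpace ℝ (Fin n)} (hx : x ∈ Ω) :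
    0 < Metric.infDist x (frontier Ω) ∧
      ∃ z, dist x z ≤ 2 * Metric.infDist x (frontier Ω) ∧
        Disjoint (Metric.ball z (Metric.infDist x (frontier Ω) / η)) (closure Ω) := by
  have hne : (frontier Ω).Nonempty := by
    rw [Set.nonempty_iff_ne_empty]
    intro hemp
    rcases isClopen_iff.1 (isClopen_iff_frontier_eq_empty.2 hemp) with h | h
    · simp [h] at hx
    · exact not_isBounded_compl hΩb (by simp [h])
  have hxf : x ∉ frontier Ω := fun h => by
    rw [hΩo.frontier_eq] at h
    exact h.2 hx
  have hd : 0 < Metric.infDist x (frontier Ω) :=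
    (isClosed_frontier.notMem_iff_infDist_pos hne).1 hxf
  -- Plumpness is used at a nearest boundary point, with the distance itself as radius; hence the
  -- factor `2`. The complement is unbounded, so this radius is admissible.
  obtain ⟨y, hy, hxy⟩ := isClosed_frontier.exists_infDist_eq_dist hne x
  have hdiam : Metric.ediam Ωᶜ = ∞ := by
    by_contra h
    exact not_isBounded_compl hΩb (Metric.isBounded_iff_ediam_ne_top.2 h)
  obtain ⟨z, hz, hball⟩ := hplump y (frontier_compl Ω ▸ hy : y ∈ frontier Ωᶜ).1
    (Metric.infDist x (frontier Ω)) hd (by rw [hdiam]; exact ENNReal.ofReal_lt_top)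
  refine ⟨hd, z, ?_, ?_⟩
  · have := dist_triangle x y z
    have := Metric.mem_closedBall'.1 hz
    linarith
  · exact (Set.disjoint_left.2 fun w hw => hball hw).closure_right Metric.isOpen_ball

theorem theorem1p2 (n : ℕ) (hn : 2 ≤ n) (s p q : ℝ) (hs₀ : 0 < s) (hs₁ : s < 1)
    (hp : 1 < p) (hq : 1 < q) (hpq : 0 < 1 / p - 1 / q) (hpqs : 1 / p - 1 / q < s / n) :
    ∃ c : ℝ, 0 < c ∧
      ∀ (η : ℝ) (Ω : Set (EuclideanSpace ℝ (Fin n))), 1 ≤ η →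
        IsOpen Ω → IsConnected Ω → Bornology.IsBounded Ω → IsPlump η Ωᶜ →
        ∀ u : EuclideanSpace ℝ (Fin n) → ℂ, MemFracSobolev s p u → tsupport u ⊆ closure Ω →
          (∫⁻ x in Ω, ‖u x‖ₑ ^ q /
              ENNReal.ofReal (Metric.infDist x (frontier Ω)) ^
                (q * (s + n * (1 / q - 1 / p)))) ^ (1 / q) ≤
            ENNReal.ofReal (c * η ^ (2 * n / q + s - n / p)) * gagliardoSeminorm s p u := by
  have : NeZero n := ⟨by omega⟩
  have hn0 : (0 : ℝ) < n := by exact_mod_cast (by omega : 0 < n)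
  have hp0 : 0 < p := by linarith
  have hq0 : 0 < q := by linarith
  have hlt : p < q := (one_div_lt_one_div hq0 hp0).1 (sub_pos.1 hpq)
  have hα : 0 < s - n * (1 / p - 1 / q) := by
    rw [lt_div_iff₀ hn0] at hpqs
    linarith
  have hαeq : s + n * (1 / q - 1 / p) = s - n * (1 / p - 1 / q) := by ring
  rw [hαeq]
  set α := s - n * (1 / p - 1 / q) with hαdef
  have heq : 2 * n / q + s - n / p = α + n / q := by rw [hαdef]; ring
  rw [heq]
  have he : 0 < α + n / q := by positivity
  have hden : 0 < n / p + 2 * α := by positivity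
  -- The requirement `n/t - s ≤ α + n/q` is `n/t ≤ n/p + 2α`; this is the least such `t ≥ 1`, and it
  -- is below `p` because `α > 0` and `p > 1`.
  set t := max 1 (n / (n / p + 2 * α))
  have ht : 1 ≤ t := le_max_left _ _
  have htp : t < p := by
    refine max_lt hp ((div_lt_iff₀ hden).2 ?_)
    have : p * (n / p + 2 * α) = n + 2 * (p * α) := by field_simp
    rw [this]
    have : 0 < p * α := by positivity
    linarith
  have hte : n / t - s ≤ α + n / q := by
    have h1 : n / t ≤ n / p + 2 * α := by
      rw [div_le_iff₀ (by linarith)]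
      have := le_max_right 1 (n / (n / p + 2 * α))
      rw [div_le_iff₀ hden] at this
      linarith
    have h2 : α = s - n / p + n / q := by rw [hαdef]; ring
    linarith
  obtain ⟨C₁, hC₁, hpt⟩ :=
    exists_ae_enorm_le_of_ae_eq_zero_on_ball (n := n) hs₀ ht htp hlt hα he hte
  obtain ⟨C₂, hC₂, hint⟩ := exists_lintegral_hedbergMajorant_le (n := n) ht htp hlt
  refine ⟨C₁ * C₂, by positivity, ?_⟩
  intro η Ω hη hΩo _ hΩb hplump u hu hsupp
  -- `u` is only a.e. measurable, so the estimates run on a measurable representative `v`; it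
  -- vanishes only a.e. off the support of `u`, which suffices for averages.
  obtain ⟨v, hvm, huv⟩ := hu.1.1
  have hvmeas : Measurable v := hvm.measurable
  have hvint : LocallyIntegrable v := (hu.1.ae_eq huv).locallyIntegrable
    (ENNReal.one_le_ofReal.2 hp.le)
  rw [gagliardoSeminorm_congr_ae huv, ← rpow_lintegral_fracGradient hp0]
  set g := fracGradient s p v
  have hptw : ∀ᵐ x, x ∈ Ω → ‖u x‖ₑ ^ q /
      ENNReal.ofReal (Metric.infDist x (frontier Ω)) ^ (q * α) ≤
        ENNReal.ofReal (C₁ * η ^ (α + n / q)) ^ q * hedbergMajorant t p q g x ^ q := by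
    filter_upwards [hpt v hvmeas hvint, huv] with x hx hux hxΩ
    obtain ⟨hd, z, hxz, hdisj⟩ := hplump.exists_ball_disjoint_closure hΩo hΩb hxΩ
    have hb := hx z _ η hd hη hxz (by
      filter_upwards [huv] with y hy hyz
      rw [← hy]
      exact image_eq_zero_of_notMem_tsupport fun h => Set.disjoint_left.1 hdisj hyz (hsupp h))
    refine ENNReal.div_le_of_le_mul ?_
    rw [hux, mul_comm q α, ENNReal.rpow_mul, ← ENNReal.mul_rpow_of_nonneg _ _ hq0.le,
      ← ENNReal.mul_rpow_of_nonneg _ _ hq0.le]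
    gcongr
    refine hb.trans_eq ?_
    rw [ENNReal.ofReal_mul (by positivity), ENNReal.ofReal_rpow_of_pos hd]
    ring
  calc _ ≤ (∫⁻ x, ENNReal.ofReal (C₁ * η ^ (α + n / q)) ^ q *
        hedbergMajorant t p q g x ^ q) ^ (1 / q) := by
        gcongr ?_ ^ _
        exact (setLIntegral_mono_ae' hΩo.measurableSet hptw).trans (setLIntegral_le_lintegral _ _)
    _ = ENNReal.ofReal (C₁ * η ^ (α + n / q)) *
        (∫⁻ x, hedbergMajorant t p q g x ^ q) ^ (1 / q) := by
        rw [lintegral_const_mul' _ _ (ENNReal.rpow_ne_top_of_nonneg hq0.le ENNReal.ofReal_ne_top),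
          ENNReal.mul_rpow_of_nonneg _ _ (by positivity), ← ENNReal.rpow_mul,
          mul_one_div_cancel hq0.ne', ENNReal.rpow_one]
    _ ≤ ENNReal.ofReal (C₁ * η ^ (α + n / q)) *
        (ENNReal.ofReal C₂ * (∫⁻ y, g y ^ p) ^ (1 / p)) := by
        gcongr
        exact hint g (measurable_fracGradient s p hvmeas)
    _ = _ := by
        rw [← mul_assoc, ← ENNReal.ofReal_mul (by positivity)]
        congr 2
        ring
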